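/- **Theorem (Convergence analysis of R-AbaSRG).** Let $\mathcal M$ be a smooth finite-dimensional Riemannian manifold, $f_1,\dots,f_n:\mathcal M\to\mathbb R$ ($n\ge 1$) and $f=\frac1n\sum_{i=1}^n f_i$. Let $R:T\mathcal M\to\mathcal M$ be a retraction (smooth, $R_x(0)=x$, $\mathrm DR_x(0)=\mathrm{id}$) and $\mathcal T$ an isometric vector transport: $\mathcal T_\xi:T_x\mathcal M\to T_{R_x(\xi)}\mathcal M$ is a linear isometry for $\xi\in T_x\mathcal M$, and $\mathcal T_{0_x}=\mathrm{id}$. For $\xi\in T_x\mathcal M$ and $y=R_x(\xi)$ let $P_x^y$ be the Levi-Civita parallel transport along $t\mapsto R_x(t\xi)$, $0\le t\le 1$, and $P_y^x=(P_x^y)^{-1}$. *Algorithm (R-AbaSRG).* Input: $\eta>0$, integers $S,m,b\ge1$, reals $\alpha_1,\alpha_2,\beta_1,\sigma,\epsilon$ and a point $\tilde x^0$. For $s=1,\dots,S$: put $x_0^s=\tilde x^{s-1}$ and $$B^s=\min\{\lceil\alpha_1\sigma^2/\beta_s\rceil,\,n\}\ \text{(finite-sum setting)},\qquad B^s=\min\{\lceil\alpha_1\sigma^2/\beta_s\rceil,\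 \lceil\alpha_2\sigma^2/\epsilon^2\rceil,\ n\}\ \text{(online setting)},$$ where $\alpha_1\sigma^2/0=\infty$; draw a uniformly random subset $\mathcal B^s\subset\{1,\dots,n\}$ of size $B^s$ and put $v_0^s=\frac1{B^s}\sum_{i\in\mathcal B^s}\operatorname{grad}f_i(x_0^s)$, $x_1^s=R_{x_0^s}(-\eta v_0^s)$. For $t=1,\dots,m-1$, draw a multiset $\mathcal I_t^s$ of $b$ independent uniform indices from $\{1,\dots,n\}$ and put $$v_t^s=\operatorname{grad}f_{\mathcal I_t^s}(x_t^s)-\mathcal T_{-\eta v_{t-1}^s}\big(\operatorname{grad}f_{\mathcal I_t^s}(x_{t-1}^s)-v_{t-1}^s\big),\qquad x_{t+1}^s=R_{x_t^s}(-\eta v_t^s),$$ where $\operatorname{grad}f_{\mathcal I}=\frac1b\sum_{i\in\mathcal I}\operatorname{grad}f_i$ (with multiplicity). Then $\beta_{s+1}=\frac1m\sum_{t=0}^{m-1}\|v_t^s\|^2$ and $\tilde x^s=x_m^s$. All draws are independent of the past. The output $\tilde x$ is chosen uniformly at random from $\{x_t^s: 1\le s\le S,\ 0\le t\le m-1\}$.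 *Assumptions.* There are a point $x^*$, a neighbourhood $\mathcal X$ of $x^*$ with $f(x^*)\le f(x)$ for all $x\in\mathcal X$, and constants $G,H,\sigma,L,L_l,\theta>0$ ($\sigma$ being the one used by the algorithm) such that: 1. all $f_i$ are twice continuously differentiable; 2. $\mathcal X$ is totally retractive: for every $x\in\mathcal X$, $R_x$ restricts to a diffeomorphism from an open neighbourhood $D_x$ of $0$ in $T_x\mathcal M$ onto an open set containing $\mathcal X$; and in every realization of the algorithm the iterates stay continuously in $\mathcal X$, i.e. $R_{x_t^s}(-\tau\eta v_t^s)\in\mathcal X$ for all $\tau\in[0,1]$, $1\le s\le S$, $0\le t\le m-1$; 3. $\|\operatorname{grad}f_i(x)\|\le G$ and $\|\operatorname{Hess}f_i(x)\|\le H$ for all $x\in\mathcal X$ and all $i$; 4. $\frac1n\sum_{i=1}^n\|\operatorname{grad}f_i(x)-\operatorname{grad}f(x)\|^2\le\sigma^2$ for all $x\in\mathcal X$; and, for all $x\in\mathcal X$ and $\xi\in D_x$ with $y=R_x(\xi)\in\mathcal X$: 5. $f(y)\le f(x)+\langle\operatorname{grad}f(x),\xi\rangle+\frac L2\|\xi\|^2$;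 6. $\frac1n\sum_{i=1}^n\|\operatorname{grad}f_i(x)-P_y^x\operatorname{grad}f_i(y)\|^2\le L_l^2\|\xi\|^2$; 7. $\|\mathcal T_\xi u-P_x^yu\|\le\theta\|\xi\|\|u\|$ for all $u\in T_x\mathcal M$. *Conclusion.* Let $\epsilon>0$, $\alpha\ge4$, $\alpha_1\ge\alpha$, in the online setting also $\alpha_2\ge\alpha$, $0\le\beta_1\le\epsilon^2S$, and $$0<\eta\le\frac{2-\frac2\alpha}{L+\sqrt{L^2+4\left(1-\frac1\alpha\right)\frac{(L_l+\theta G)^2m}{b}}}.$$ Then, in both the finite-sum and the online setting, with $T=Sm$ and $\Delta=f(\tilde x^0)-f(x^*)$, $$\mathbb E\|\operatorname{grad}f(\tilde x)\|^2\le\frac{2\Delta}{T\eta}+\frac{\epsilon^2}2 .$$ -/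

import Mathlib

open Set Bundle Manifold
open scoped ContDiff Topology BigOperators

noncomputable section

section Geometry

variable (E : Type*) [NormedAddCommGroup E] [NormedSpace ℝ E] [FiniteDimensional ℝ E]
  {M : Type*} [TopologicalSpace M] [ChartedSpace E M]

instance tangentSpaceFiniteDimensional (x : M) :
    FiniteDimensional ℝ (TangentSpace 𝓘(ℝ, E) x) :=
  inferInstanceAs (FiniteDimensional ℝ E)

/-- The Riemannian gradient: the tangent vector `grad h x` at `x` with
`⟨grad h x, v⟩ = dh_x(v)` for all `v`. -/
def rgrad [IsManifold 𝓘(ℝ, E) ∞ M]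
    [RiemannianBundle (fun x : M ↦ TangentSpace 𝓘(ℝ, E) x)]
    (h : M → ℝ) (x : M) : TangentSpace 𝓘(ℝ, E) x :=
  haveI : CompleteSpace (TangentSpace 𝓘(ℝ, E) x) :=
    FiniteDimensional.complete ℝ (TangentSpace 𝓘(ℝ, E) x)
  (InnerProductSpace.toDual ℝ (TangentSpace 𝓘(ℝ, E) x)).symm
    (mfderiv 𝓘(ℝ, E) 𝓘(ℝ, ℝ) h x)

variable (M) in
/-- A retraction: a smooth map `R : TM → M`, written `R x ξ`, with `R x 0 = x` and
`D(R x)(0) = id`. -/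
structure Retraction [IsManifold 𝓘(ℝ, E) ∞ M] where
  toFun : ∀ x : M, TangentSpace 𝓘(ℝ, E) x → M
  contMDiff : ContMDiff (𝓘(ℝ, E).tangent) 𝓘(ℝ, E) ∞
    (fun p : TangentBundle 𝓘(ℝ, E) M ↦ toFun p.proj p.snd)
  map_zero : ∀ x, toFun x 0 = x
  mfderiv_zero : ∀ (x : M) (ξ : E),
    (⟨toFun x (0 : E), mfderiv 𝓘(ℝ, E) 𝓘(ℝ, E) (M := E) (toFun x) (0 : E) ξ⟩ :
      TangentBundle 𝓘(ℝ, E) M) = ⟨x, ξ⟩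

instance [IsManifold 𝓘(ℝ, E) ∞ M] :
    CoeFun (Retraction E M) (fun _ ↦ ∀ x : M, TangentSpace 𝓘(ℝ, E) x → M) :=
  ⟨Retraction.toFun⟩

variable {E}
variable [IsManifold 𝓘(ℝ, E) ∞ M]
  [RiemannianBundle (fun x : M ↦ TangentSpace 𝓘(ℝ, E) x)]

/-- An isometric vector transport associated with the retraction `R`: for each direction `ξ` at
`x`, a linear map `T x ξ` from the tangent space at `x` to the tangent space at `R x ξ` that
preserves the inner product, with `T x 0 = id`. -/
structure VectorTransport (R : Retraction E M) where
  toFun : ∀ (x : M) (ξ : TangentSpace 𝓘(ℝ, E) x),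
    TangentSpace 𝓘(ℝ, E) x →ₗᵢ[ℝ] TangentSpace 𝓘(ℝ, E) (R x ξ)
  map_zero : ∀ (x : M) (v : TangentSpace 𝓘(ℝ, E) x),
    (⟨R x 0, toFun x 0 v⟩ : TangentBundle 𝓘(ℝ, E) M) = ⟨x, v⟩

instance (R : Retraction E M) : CoeFun (VectorTransport R) (fun _ ↦
    ∀ (x : M) (ξ : TangentSpace 𝓘(ℝ, E) x),
      TangentSpace 𝓘(ℝ, E) x →ₗᵢ[ℝ] TangentSpace 𝓘(ℝ, E) (R x ξ)) :=
  ⟨VectorTransport.toFun⟩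

/-- `nabla` is the Levi-Civita connection: it is compatible with the metric,
`d⟨Y, Z⟩(v) = ⟨∇_v Y, Z⟩ + ⟨Y, ∇_v Z⟩`, and torsion free. -/
def IsLeviCivita
    (nabla : CovariantDerivative 𝓘(ℝ, E) E (fun x : M ↦ TangentSpace 𝓘(ℝ, E) x)) : Prop :=
  (∀ (Y Z : ∀ x : M, TangentSpace 𝓘(ℝ, E) x) (x : M),
    MDifferentiableAt 𝓘(ℝ, E) (𝓘(ℝ, E).tangent)
      (fun y ↦ (⟨y, Y y⟩ : TangentBundle 𝓘(ℝ, E) M)) x →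
    MDifferentiableAt 𝓘(ℝ, E) (𝓘(ℝ, E).tangent)
      (fun y ↦ (⟨y, Z y⟩ : TangentBundle 𝓘(ℝ, E) M)) x →
    ∀ v : TangentSpace 𝓘(ℝ, E) x,
      inner ℝ (nabla Y x v) (Z x) + inner ℝ (Y x) (nabla Z x v) =
        mfderiv 𝓘(ℝ, E) 𝓘(ℝ, ℝ) (fun y ↦ inner ℝ (Y y) (Z y)) x v) ∧
  nabla.torsion = 0

/-- The vector field `V` along its base curve `c = π ∘ V` has vanishing covariant derivative at
time `t`. With `w` the coordinates of `V` in the tangent bundle chart around `c t`, the covariant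
derivative of `V` at `t` is `w'(t) + ∇_{c'(t)} e`, where `e` is the local vector field extending
`V t` with constant coordinates. -/
def IsParallelAt
    (nabla : CovariantDerivative 𝓘(ℝ, E) E (fun x : M ↦ TangentSpace 𝓘(ℝ, E) x))
    (V : ℝ → TangentBundle 𝓘(ℝ, E) M) (t : ℝ) : Prop :=
  MDifferentiableAt 𝓘(ℝ, ℝ) (𝓘(ℝ, E).tangent) V t ∧
    (trivializationAt E (fun x : M ↦ TangentSpace 𝓘(ℝ, E) x) (V t).proj).symm (V t).proj
        (deriv (fun τ ↦ (trivializationAt E (fun x : M ↦ TangentSpace 𝓘(ℝ, E) x)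
          (V t).proj (V τ)).2) t)
      + nabla (FiberBundle.extend E (V t).snd) (V t).proj
        (mfderiv 𝓘(ℝ, ℝ) 𝓘(ℝ, E) (fun τ ↦ (V τ).proj) t (1 : ℝ)) = 0

/-- `P` is the parallel transport, for the connection `nabla`, along the retraction curve
`t ↦ R x (t • ξ)`, `0 ≤ t ≤ 1`, from its start `x` to its end `R x ξ`. -/
def IsParallelTransport
    (nabla : CovariantDerivative 𝓘(ℝ, E) E (fun x : M ↦ TangentSpace 𝓘(ℝ, E) x))
    (R : Retraction E M) (x : M) (ξ : TangentSpace 𝓘(ℝ, E) x)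
    (P : TangentSpace 𝓘(ℝ, E) x ≃ₗᵢ[ℝ] TangentSpace 𝓘(ℝ, E) (R x ξ)) : Prop :=
  ∀ u : TangentSpace 𝓘(ℝ, E) x, ∃ V : ℝ → TangentBundle 𝓘(ℝ, E) M,
    (∀ t, (V t).proj = R x (t • ξ)) ∧
    (∀ t ∈ Icc (0 : ℝ) 1, IsParallelAt nabla V t) ∧
    V 0 = ⟨x, u⟩ ∧ V 1 = ⟨R x ξ, P u⟩

end Geometry

section Algorithm

/-- The two variants of the algorithm. -/
inductive Setting
  | finiteSum
  | online

/-- Input parameters of the algorithm: variant, step size `η`, number of epochs `S`, inner loop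
size `m`, mini-batch size `b`, adaptive batch size parameters `α₁`, `α₂`, `β₁`, variance bound
`σ` and desired accuracy `ε`. -/
structure Params where
  setting : Setting
  η : ℝ
  S : ℕ+
  m : ℕ+
  b : ℕ+
  α₁ : ℝ
  α₂ : ℝ
  β₁ : ℝ
  σ : ℝ
  ε : ℝ

/-- The upper limit of the outer batch size: `n` in the finite-sum setting and `α₂ σ² / ε²` in the
online setting (rounded up, and at most the population size `n`, as the batch is drawn without
replacement). -/
def Params.batchCap (p : Params) (n : ℕ) : ℕ :=
  match p.setting with
  | .finiteSum => n
  | .online => min ⌈p.α₂ * p.σ ^ 2 / p.ε ^ 2⌉₊ n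

/-- The outer batch size `min {α₁ σ² / β, cap}` (rounded up), where `α₁ σ² / 0 = ∞`. -/
def Params.batchSize (p : Params) (n : ℕ) (β : ℝ) : ℕ :=
  if β = 0 then p.batchCap n else min ⌈p.α₁ * p.σ ^ 2 / β⌉₊ (p.batchCap n)

lemma Params.batchCap_le (p : Params) (n : ℕ) : p.batchCap n ≤ n := by
  unfold Params.batchCap
  split <;> simp

lemma Params.batchSize_le (p : Params) (n : ℕ) (β : ℝ) : p.batchSize n β ≤ n := by
  unfold Params.batchSize
  split
  · exact p.batchCap_le n
  · exact (min_le_right _ _).trans (p.batchCap_le n)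

lemma Params.powersetCard_nonempty (p : Params) (n : ℕ) (β : ℝ) :
    (Finset.powersetCard (p.batchSize n β) (Finset.univ : Finset (Fin n))).Nonempty := by
  rw [Finset.powersetCard_nonempty]
  simpa using p.batchSize_le n β

variable {E : Type*} [NormedAddCommGroup E] [NormedSpace ℝ E] [FiniteDimensional ℝ E]
  {M : Type*} [TopologicalSpace M] [ChartedSpace E M] [IsManifold 𝓘(ℝ, E) ∞ M]
  [RiemannianBundle (fun x : M ↦ TangentSpace 𝓘(ℝ, E) x)]
  {n : ℕ} [NeZero n]

/-- The objective `(1/n) ∑ i, f i`. -/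
def objective (f : Fin n → M → ℝ) (x : M) : ℝ := (n : ℝ)⁻¹ * ∑ i, f i x

variable (E) in
/-- The batch gradient of a set `𝓑` of distinct components. -/
def batchGrad (f : Fin n → M → ℝ) (𝓑 : Finset (Fin n)) (x : M) : TangentSpace 𝓘(ℝ, E) x :=
  (𝓑.card : ℝ)⁻¹ • ∑ i ∈ 𝓑, rgrad E (f i) x

variable (E) in
/-- The mini-batch gradient of a sequence of `b` components, repetitions allowed. -/
def miniGrad (f : Fin n → M → ℝ) {b : ℕ} (𝓘 : Fin b → Fin n) (x : M) :
    TangentSpace 𝓘(ℝ, E) x :=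
  (b : ℝ)⁻¹ • ∑ j, rgrad E (f (𝓘 j)) x

variable (p : Params) (R : Retraction E M) (T : VectorTransport R) (f : Fin n → M → ℝ)

/-- The update `x ↦ R x (-η v)` from a state `(x, v)`. -/
abbrev advance (z : TangentBundle 𝓘(ℝ, E) M) : M := R z.proj (-(p.η • z.snd))

variable (E) in
/-- Start of an epoch at `x`: draw a batch of size `batchSize β` uniformly without replacement and
return `(x, v₀)`. -/
def epochStart (β : ℝ) (x : M) : PMF (TangentBundle 𝓘(ℝ, E) M) :=
  (PMF.uniformOfFinset _ (p.powersetCard_nonempty n β)).map fun 𝓑 ↦ ⟨x, batchGrad E f 𝓑 x⟩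

/-- One inner step, from `(x, v) = (x_{t-1}, v_{t-1})` to `(x_t, v_t)`: draw a mini-batch of size
`b` uniformly with replacement and form the recursive gradient estimator. -/
def innerStep (z : TangentBundle 𝓘(ℝ, E) M) : PMF (TangentBundle 𝓘(ℝ, E) M) :=
  (PMF.uniformOfFintype (Fin p.b → Fin n)).map fun 𝓘 ↦
    ⟨advance p R z, miniGrad E f 𝓘 (advance p R z)
      - T z.proj (-(p.η • z.snd)) (miniGrad E f 𝓘 z.proj - z.snd)⟩

/-- `k` inner steps from the state `z`: the list of the `k + 1` visited states, beginning with
`z`, together with the iterate that follows the last of them. -/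
def innerLoop : ℕ → TangentBundle 𝓘(ℝ, E) M → PMF (List (TangentBundle 𝓘(ℝ, E) M) × M)
  | 0, z => PMF.pure ([z], advance p R z)
  | k + 1, z => (innerStep p R T f z).bind fun z' ↦
      (innerLoop k z').map fun r ↦ (z :: r.1, r.2)

/-- The quantity `β_{s+1} = (1/m) ∑ t, ‖v_t‖²` computed from the states of epoch `s`. -/
def nextBeta (l : List (TangentBundle 𝓘(ℝ, E) M)) : ℝ :=
  (l.map fun z ↦ ‖z.snd‖ ^ 2 / (p.m : ℝ)).sum

/-- `k` epochs, the first one with parameter `β` and started at `x`: the list of all states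
`(x_t^s, v_t^s)`, `0 ≤ t ≤ m - 1`, in the order in which they are visited. -/
def epochs : ℕ → ℝ → M → PMF (List (TangentBundle 𝓘(ℝ, E) M))
  | 0, _, _ => PMF.pure []
  | k + 1, β, x => (epochStart E p f β x).bind fun z ↦
      (innerLoop p R T f ((p.m : ℕ) - 1) z).bind fun r ↦
        (epochs k (nextBeta p r.1) r.2).map fun l ↦ r.1 ++ l

/-- A full run of R-AbaSRG from `x₀`: the list of its `T = S m` states. -/
def run (x₀ : M) : PMF (List (TangentBundle 𝓘(ℝ, E) M)) := epochs p R T f p.S p.β₁ x₀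

/-- The output of R-AbaSRG: an iterate chosen uniformly at random among the `S m` iterates of a
run. (The default value of `getD` is never used, see `length_of_mem_support_run`.) -/
def output (x₀ : M) : PMF M :=
  (run p R T f x₀).bind fun l ↦
    (PMF.uniformOfFintype (Fin ((p.S : ℕ) * (p.m : ℕ)))).map
      fun k : Fin ((p.S : ℕ) * (p.m : ℕ)) ↦ (l.getD (k : ℕ) ⟨x₀, 0⟩).proj

/-- The expectation of `g` under `q`. The series is a finite sum for the output of the
algorithm, see `finite_support_output`. -/
def expect {A : Type*} (q : PMF A) (g : A → ℝ) : ℝ := ∑' a, (q a).toReal * g a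

lemma length_of_mem_support_innerLoop (k : ℕ) (z : TangentBundle 𝓘(ℝ, E) M) :
    ∀ r ∈ (innerLoop p R T f k z).support, r.1.length = k + 1 := by
  induction k generalizing z with
  | zero => intro r hr; simp [innerLoop] at hr; simp [hr]
  | succ k ih =>
    intro r hr
    simp only [innerLoop, PMF.mem_support_bind_iff, PMF.mem_support_map_iff] at hr
    obtain ⟨z', -, r', hr', rfl⟩ := hr
    simp [ih z' r' hr']

lemma length_of_mem_support_epochs (k : ℕ) (β : ℝ) (x : M) :
    ∀ l ∈ (epochs p R T f k β x).support, l.length = k * p.m := by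
  induction k generalizing β x with
  | zero => intro l hl; simp [epochs] at hl; simp [hl]
  | succ k ih =>
    intro l hl
    simp only [epochs, PMF.mem_support_bind_iff, PMF.mem_support_map_iff] at hl
    obtain ⟨z, -, r, hr, l', hl', rfl⟩ := hl
    have h1 := length_of_mem_support_innerLoop p R T f _ z r hr
    have h2 := ih _ _ l' hl'
    have h3 := p.m.pos
    rw [List.length_append, h1, h2, Nat.sub_add_cancel h3]
    ring

lemma length_of_mem_support_run (x₀ : M) :
    ∀ l ∈ (run p R T f x₀).support, l.length = p.S * p.m :=
  length_of_mem_support_epochs p R T f p.S p.β₁ x₀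

lemma finite_support_bind {A B : Type*} (q : PMF A) (g : A → PMF B) (hq : q.support.Finite)
    (hg : ∀ a, (g a).support.Finite) : (q.bind g).support.Finite := by
  rw [PMF.support_bind]
  exact hq.biUnion fun a _ ↦ hg a

lemma finite_support_map {A B : Type*} (q : PMF A) (g : A → B) (hq : q.support.Finite) :
    (q.map g).support.Finite := by
  rw [PMF.support_map]
  exact hq.image g

lemma finite_support_innerLoop (k : ℕ) (z : TangentBundle 𝓘(ℝ, E) M) :
    (innerLoop p R T f k z).support.Finite := by
  induction k generalizing z with
  | zero => simp [innerLoop]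
  | succ k ih =>
    exact finite_support_bind _ _ (finite_support_map _ _ (Set.toFinite _))
      fun z' ↦ finite_support_map _ _ (ih z')

lemma finite_support_epochs (k : ℕ) (β : ℝ) (x : M) :
    (epochs p R T f k β x).support.Finite := by
  induction k generalizing β x with
  | zero => simp [epochs]
  | succ k ih =>
    exact finite_support_bind _ _ (finite_support_map _ _ (Set.toFinite _)) fun z ↦
      finite_support_bind _ _ (finite_support_innerLoop p R T f _ z) fun r ↦
        finite_support_map _ _ (ih _ _)

lemma finite_support_output (x₀ : M) : (output p R T f x₀).support.Finite :=
  finite_support_bind _ _ (finite_support_epochs p R T f _ _ _) fun _ ↦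
    finite_support_map _ _ (Set.toFinite _)

end Algorithm

section Assumption

variable {E : Type*} [NormedAddCommGroup E] [NormedSpace ℝ E] [FiniteDimensional ℝ E]
  {M : Type*} [TopologicalSpace M] [ChartedSpace E M] [IsManifold 𝓘(ℝ, E) ∞ M]
  [RiemannianBundle (fun x : M ↦ TangentSpace 𝓘(ℝ, E) x)]
  {n : ℕ}

/-- `X` is a totally retractive neighbourhood of `xs`: around every `x ∈ X`, `R x` restricts to a
diffeomorphism `Φ x` from an open neighbourhood of `0` in the tangent space at `x` onto an open
set that contains `X`. For `x, y ∈ X`, `(Φ x).symm y` is thus the tangent vector `(R x)⁻¹ y`. -/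
structure IsTotallyRetractive (R : Retraction E M) (X : Set M) (xs : M)
    (Φ : ∀ _ : M, PartialDiffeomorph 𝓘(ℝ, E) 𝓘(ℝ, E) E M ∞) : Prop where
  mem_nhds : X ∈ 𝓝 xs
  zero_mem : ∀ x ∈ X, (0 : E) ∈ (Φ x).source
  eqOn : ∀ x ∈ X, ∀ ξ ∈ (Φ x).source, Φ x ξ = R x ξ
  subset_target : ∀ x ∈ X, X ⊆ (Φ x).target

/-- The standing assumptions on the components `f i`, on the neighbourhood `X` of the optimal
point `xs`, and on the constants. The quantified vector `ξ` is `(R x)⁻¹ y` with `y = R x ξ`,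
and `P x ξ` is the parallel transport from `x` to `y` along `t ↦ R x (t • ξ)`. -/
structure CommonAssumption
    (nabla : CovariantDerivative 𝓘(ℝ, E) E (fun x : M ↦ TangentSpace 𝓘(ℝ, E) x))
    (R : Retraction E M) (T : VectorTransport R)
    (P : ∀ (x : M) (ξ : TangentSpace 𝓘(ℝ, E) x),
      TangentSpace 𝓘(ℝ, E) x ≃ₗᵢ[ℝ] TangentSpace 𝓘(ℝ, E) (R x ξ))
    (f : Fin n → M → ℝ) (X : Set M) (xs : M)
    (Φ : ∀ _ : M, PartialDiffeomorph 𝓘(ℝ, E) 𝓘(ℝ, E) E M ∞)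
    (G H σ L Ll θ : ℝ) : Prop where
  contMDiff : ∀ i, ContMDiff 𝓘(ℝ, E) 𝓘(ℝ, ℝ) 2 (f i)
  totallyRetractive : IsTotallyRetractive R X xs Φ
  grad_bound : ∀ i, ∀ x ∈ X, ‖rgrad E (f i) x‖ ≤ G
  hess_bound : ∀ i, ∀ x ∈ X, ∀ v : TangentSpace 𝓘(ℝ, E) x,
    ‖nabla (fun y ↦ rgrad E (f i) y) x v‖ ≤ H * ‖v‖
  variance_bound : ∀ x ∈ X,
    (n : ℝ)⁻¹ * ∑ i, ‖rgrad E (f i) x - rgrad E (objective f) x‖ ^ 2 ≤ σ ^ 2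
  smooth : ∀ x ∈ X, ∀ ξ : TangentSpace 𝓘(ℝ, E) x, ξ ∈ (Φ x).source → R x ξ ∈ X →
    objective f (R x ξ) ≤ objective f x
      + inner ℝ (rgrad E (objective f) x) ξ
      + L / 2 * ‖ξ‖ ^ 2
  lipschitz : ∀ x ∈ X, ∀ ξ : TangentSpace 𝓘(ℝ, E) x, ξ ∈ (Φ x).source → R x ξ ∈ X →
    (n : ℝ)⁻¹ * ∑ i, ‖rgrad E (f i) x - (P x ξ).symm (rgrad E (f i) (R x ξ))‖ ^ 2
      ≤ Ll ^ 2 * ‖ξ‖ ^ 2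
  transport : ∀ x ∈ X, ∀ ξ : TangentSpace 𝓘(ℝ, E) x, ξ ∈ (Φ x).source → R x ξ ∈ X →
    ∀ u : TangentSpace 𝓘(ℝ, E) x,
      ‖T x ξ u - P x ξ u‖ ≤ θ * ‖ξ‖ * ‖u‖

end Assumption

end

/-! Write `e = ‖v - grad f(x)‖²` for the squared error of the estimator at a state `(x, v)`, and `κ
= (L_l + θG)² η² / b`. Smoothness and polarization (`CommonAssumption.descent`) show that one update
lowers the objective by at least `η/2 ‖grad f‖² + η/2 (1 - Lη) ‖v‖² - η/2 e`, so everything rests on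
controlling `e`.

Within an epoch, the new error is the transported old error plus a centred sum of independent terms.
The transport is isometric and the cross terms vanish on average, so the mean of `e` grows by at
most `κ ‖v‖²` per step (`expect_innerStep_sqError_le`). An error made at one state is charged again
at every later state of the epoch, hence at most `m` times. The step size gives `mκ + Lη ≤ 1 - 1/α`;
the descent therefore absorbs this growth and still leaves `η/(2α) ∑ ‖v_t‖²` unspent
(`expect_innerLoop_le`).

At the start of epoch `s`, the adaptive batch size makes the mean of `e` at most `β_s/α + ε²/α`
(`expect_epochStart_sqError_le`), at a total cost of `ηm/2` times this. Since `mβ_{s+1} = ∑ ‖v_t‖²`,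
the unspent part of epoch `s` is exactly the `β_{s+1}` cost of the next epoch. The costs telescope
over the epochs (`expect_epochs_le`), and only `β₁/α + Sε²/α ≤ 2Sε²/α ≤ Sε²/2` remains. -/

/-! ### Expectations under finitely supported distributions. -/

section Expectation

variable {A B : Type*}

lemma expect_eq_sum (q : PMF A) (g : A → ℝ) (s : Finset A) (hs : ∀ a ∉ s, q a = 0) :
    expect q g = ∑ a ∈ s, (q a).toReal * g a :=
  tsum_eq_sum fun a ha ↦ by simp [hs a ha]

lemma expect_eq_sum_support (q : PMF A) (hq : q.support.Finite) (g : A → ℝ) :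
    expect q g = ∑ a ∈ hq.toFinset, (q a).toReal * g a :=
  expect_eq_sum q g _ fun a ha ↦ by simpa [PMF.mem_support_iff] using ha

lemma expect_pure (a : A) (g : A → ℝ) : expect (PMF.pure a) g = g a := by
  classical
  rw [expect_eq_sum _ g {a} (by intro b hb; simp_all)]
  simp

lemma expect_bind (q : PMF A) (k : A → PMF B) (hq : q.support.Finite)
    (hk : ∀ a, (k a).support.Finite) (g : B → ℝ) :
    expect (q.bind k) g = expect q fun a ↦ expect (k a) g := by
  have hb := finite_support_bind q k hq hk
  rw [expect_eq_sum_support _ hb, expect_eq_sum_support _ hq]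
  have h1 : ∀ b, ((q.bind k) b).toReal =
      ∑ a ∈ hq.toFinset, (q a).toReal * (k a b).toReal := by
    intro b
    rw [PMF.bind_apply, tsum_eq_sum (s := hq.toFinset), ENNReal.toReal_sum]
    · simp
    · intro a _
      exact ENNReal.mul_ne_top (q.apply_ne_top a) ((k a).apply_ne_top b)
    · intro a ha
      have : q a = 0 := by simpa [PMF.mem_support_iff] using ha
      simp [this]
  simp_rw [h1, Finset.sum_mul]
  rw [Finset.sum_comm]
  refine Finset.sum_congr rfl fun a ha ↦ ?_
  rw [expect_eq_sum (k a) g hb.toFinset, Finset.mul_sum]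
  · simp [mul_assoc]
  · intro b hb'
    by_contra h0
    refine hb' ?_
    simp only [Set.Finite.mem_toFinset, PMF.mem_support_bind_iff]
    exact ⟨a, by simpa using ha, by simpa [PMF.mem_support_iff] using h0⟩

lemma expect_map (q : PMF A) (k : A → B) (hq : q.support.Finite) (g : B → ℝ) :
    expect (q.map k) g = expect q fun a ↦ g (k a) := by
  rw [PMF.map, expect_bind _ _ hq]
  · simp [expect_pure]
  · intro a; simp

lemma expect_mono (q : PMF A) (hq : q.support.Finite) {g h : A → ℝ}
    (hgh : ∀ a ∈ q.support, g a ≤ h a) : expect q g ≤ expect q h := by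
  rw [expect_eq_sum_support _ hq, expect_eq_sum_support _ hq]
  exact Finset.sum_le_sum fun a ha ↦
    mul_le_mul_of_nonneg_left (hgh a (by simpa using ha)) ENNReal.toReal_nonneg

lemma expect_congr (q : PMF A) (hq : q.support.Finite) {g h : A → ℝ}
    (hgh : ∀ a ∈ q.support, g a = h a) : expect q g = expect q h :=
  le_antisymm (expect_mono q hq fun a ha ↦ (hgh a ha).le)
    (expect_mono q hq fun a ha ↦ (hgh a ha).ge)

lemma expect_const (q : PMF A) (c : ℝ) : expect q (fun _ ↦ c) = c := by
  unfold expect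
  rw [tsum_mul_right, ← ENNReal.tsum_toReal_eq q.apply_ne_top, q.tsum_coe]
  simp

lemma expect_add (q : PMF A) (hq : q.support.Finite) (g h : A → ℝ) :
    expect q (fun a ↦ g a + h a) = expect q g + expect q h := by
  simp only [expect_eq_sum_support _ hq, mul_add, Finset.sum_add_distrib]

lemma expect_const_mul (q : PMF A) (c : ℝ) (g : A → ℝ) :
    expect q (fun a ↦ c * g a) = c * expect q g := by
  unfold expect
  rw [← tsum_mul_left]
  exact tsum_congr fun a ↦ by ring

lemma expect_affine (q : PMF A) (hq : q.support.Finite) (c d : ℝ) (g : A → ℝ) :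
    expect q (fun a ↦ c + d * g a) = c + d * expect q g := by
  rw [expect_add q hq, expect_const, expect_const_mul]

lemma expect_uniformOfFinset (s : Finset A) (hs : s.Nonempty) (g : A → ℝ) :
    expect (PMF.uniformOfFinset s hs) g = (s.card : ℝ)⁻¹ * ∑ a ∈ s, g a := by
  rw [expect_eq_sum _ g s (fun a ha ↦ PMF.uniformOfFinset_apply_of_notMem hs ha),
    Finset.mul_sum]
  refine Finset.sum_congr rfl fun a ha ↦ ?_
  rw [PMF.uniformOfFinset_apply_of_mem hs ha]
  simp

lemma expect_uniformOfFintype [Fintype A] [Nonempty A] (g : A → ℝ) :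
    expect (PMF.uniformOfFintype A) g = (Fintype.card A : ℝ)⁻¹ * ∑ a, g a :=
  expect_uniformOfFinset _ _ _

end Expectation

/-! ### Second moments of sample means, with and without replacement. -/

section Sampling

variable {V : Type*} [NormedAddCommGroup V] [InnerProductSpace ℝ V]

/-- Independent uniform samples from a centred family have orthogonal increments on average. -/
lemma average_norm_add_sum_sq {n : ℕ} [NeZero n] (d : Fin n → V) (hd : ∑ i, d i = 0) (b : ℕ) :
    ∀ w : V, ((n : ℝ) ^ b)⁻¹ * ∑ I : Fin b → Fin n, ‖w + ∑ j, d (I j)‖ ^ 2 =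
      ‖w‖ ^ 2 + b * ((n : ℝ)⁻¹ * ∑ i, ‖d i‖ ^ 2) := by
  have hn : (n : ℝ) ≠ 0 := NeZero.ne _
  induction b with
  | zero => intro w; simp
  | succ b ih =>
    intro w
    -- Split off the first draw `i` and use the induction hypothesis at the shifted vector `w + d
    -- i`; the cross term `⟨w, d i⟩` then sums to zero over `i`.
    rw [← (Fin.consEquiv fun _ ↦ Fin n).sum_comp, Fintype.sum_prod_type]
    simp only [Fin.consEquiv_apply, Fin.sum_univ_succ, Fin.cons_zero, Fin.cons_succ, ← add_assoc]
    have h1 : ∀ i, ∑ I : Fin b → Fin n, ‖w + d i + ∑ j, d (I j)‖ ^ 2 = (n : ℝ) ^ b *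
        (‖w + d i‖ ^ 2 + b * ((n : ℝ)⁻¹ * ∑ i, ‖d i‖ ^ 2)) := by
      intro i
      rw [← ih (w + d i)]
      field_simp
    simp_rw [h1, norm_add_sq_real]
    rw [← Finset.mul_sum, Finset.sum_add_distrib, Finset.sum_add_distrib, Finset.sum_add_distrib,
      ← Finset.mul_sum, ← inner_sum, hd]
    simp
    field_simp
    ring

/-- Expanding around the mean, the cross term vanishes because the deviations sum to zero. With `c =
0` this bounds the variance by the second moment. -/
lemma sum_norm_sub_average_sq_le {ι : Type*} [Fintype ι] [Nonempty ι] (a : ι → V) (c : V) :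
    ∑ i, ‖a i - (Fintype.card ι : ℝ)⁻¹ • ∑ j, a j‖ ^ 2 ≤ ∑ i, ‖a i - c‖ ^ 2 := by
  set μ : V := (Fintype.card ι : ℝ)⁻¹ • ∑ j, a j
  have hN : (Fintype.card ι : ℝ) ≠ 0 := by simp
  have h0 : ∑ i, (a i - μ) = 0 := by
    rw [Finset.sum_sub_distrib, Finset.sum_const, Finset.card_univ, ← Nat.cast_smul_eq_nsmul ℝ]
    simp [μ, smul_smul, hN]
  have h : ∀ i, ‖a i - c‖ ^ 2 =
      ‖a i - μ‖ ^ 2 + 2 * inner ℝ (a i - μ) (μ - c) + ‖μ - c‖ ^ 2 := by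
    intro i
    rw [← norm_add_sq_real]
    simp
  simp_rw [h, Finset.sum_add_distrib]
  rw [← Finset.mul_sum, ← sum_inner, h0]
  simp
  positivity

/-- The variance of the mean of a uniformly random `k`-element batch, drawn without replacement
from a centred family, is at most the one for independent draws. -/
lemma average_norm_batch_sq_le {n : ℕ} [NeZero n] (c : Fin n → V) (hc : ∑ i, c i = 0) (k : ℕ)
    (hk : k ≤ n) (hk0 : 0 < k) :
    ((Finset.powersetCard k (Finset.univ : Finset (Fin n))).card : ℝ)⁻¹ *
        ∑ s ∈ Finset.powersetCard k (Finset.univ : Finset (Fin n)),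
          ‖(s.card : ℝ)⁻¹ • ∑ i ∈ s, c i‖ ^ 2 ≤
      (k : ℝ)⁻¹ * ((n : ℝ)⁻¹ * ∑ i, ‖c i‖ ^ 2) := by
  set Q := Finset.powersetCard k (Finset.univ : Finset (Fin n)) with hQ
  have hn : (0 : ℝ) < n := by exact_mod_cast Nat.pos_of_ne_zero (NeZero.ne n)
  have hkr : (0 : ℝ) < k := by exact_mod_cast hk0
  have hcard : Q.card = n.choose k := by simp [hQ]
  -- Count the batches containing both `i` and `j`. The case `k = 1` is separated because truncated
  -- subtraction would give `(n - 2).choose 0 = 1` instead of `0`.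
  have hpair : ∀ i j : Fin n, ((Q.filter fun s ↦ i ∈ s ∧ j ∈ s).card : ℝ) =
      if i = j then ((n - 1).choose (k - 1) : ℝ)
      else (if 2 ≤ k then ((n - 2).choose (k - 2) : ℝ) else 0) := by
    intro i j
    have h1 : (Q.filter fun s ↦ i ∈ s ∧ j ∈ s) = Q.filter fun s ↦ {i, j} ⊆ s :=
      Finset.filter_congr fun s _ ↦ by simp [Finset.insert_subset_iff]
    rw [h1]
    split_ifs with hij h2
    · subst hij
      rw [hQ, Finset.card_filter_powersetCard_subset _ _ _ (by simp)
        (by rw [Finset.pair_eq_singleton, Finset.card_singleton]; exact hk0)]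
      simp
    · rw [hQ, Finset.card_filter_powersetCard_subset _ _ _ (by simp)
        (by rw [Finset.card_pair hij]; exact h2), Finset.card_pair hij]
      simp
    · rw [Finset.filter_eq_empty_iff.2, Finset.card_empty, Nat.cast_zero]
      intro s hs hsub
      have := Finset.card_le_card hsub
      rw [Finset.card_pair hij, (Finset.mem_powersetCard_univ.1 hs)] at this
      exact h2 this
  set N1 : ℝ := ((n - 1).choose (k - 1) : ℝ)
  set N2 : ℝ := if 2 ≤ k then ((n - 2).choose (k - 2) : ℝ) else 0
  have hN2 : 0 ≤ N2 := by
    simp only [N2]; split_ifs <;> positivity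
  -- The coefficient matrix of the inner products is `(N1 - N2) • 1` plus the constant matrix `N2`;
  -- the latter contributes nothing since `∑ c i = 0`.
  have hsq : ∑ s ∈ Q, ‖∑ i ∈ s, c i‖ ^ 2 = (N1 - N2) * ∑ i, ‖c i‖ ^ 2 := by
    have h1 : ∀ s : Finset (Fin n), ‖∑ i ∈ s, c i‖ ^ 2 =
        ∑ i, ∑ j, if i ∈ s ∧ j ∈ s then inner ℝ (c i) (c j) else 0 := by
      intro s
      rw [← real_inner_self_eq_norm_sq, sum_inner]
      simp_rw [inner_sum]
      simp [ite_and, Finset.sum_ite_mem]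
    simp_rw [h1]
    rw [Finset.sum_comm]
    have h2 : ∀ i, ∑ s ∈ Q, ∑ j, (if i ∈ s ∧ j ∈ s then inner ℝ (c i) (c j) else 0) =
        (N1 - N2) * ‖c i‖ ^ 2 := by
      intro i
      rw [Finset.sum_comm]
      have h3 : ∀ j, ∑ s ∈ Q, (if i ∈ s ∧ j ∈ s then inner ℝ (c i) (c j) else 0) =
          (if i = j then (N1 - N2) * inner ℝ (c i) (c j) else 0) + N2 * inner ℝ (c i) (c j) := by
        intro j
        rw [← Finset.sum_filter, Finset.sum_const, nsmul_eq_mul, hpair i j]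
        split_ifs <;> ring
      simp_rw [h3, Finset.sum_add_distrib]
      rw [← Finset.mul_sum, ← inner_sum, hc]
      simp
    simp_rw [h2, Finset.mul_sum]
  have hN1 : (n : ℝ) * N1 = k * Q.card := by
    obtain ⟨n', rfl⟩ := Nat.exists_eq_succ_of_ne_zero (NeZero.ne n)
    obtain ⟨k', rfl⟩ := Nat.exists_eq_succ_of_ne_zero hk0.ne'
    have := Nat.add_one_mul_choose_eq n' k'
    rw [hcard, mul_comm ((k'.succ : ℕ) : ℝ)]
    simp only [N1, Nat.succ_eq_add_one, Nat.add_sub_cancel]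
    exact_mod_cast this
  have hQ0 : (0 : ℝ) < Q.card := by
    rw [hcard]; exact_mod_cast Nat.choose_pos hk
  have h4 : ∑ s ∈ Q, ‖(s.card : ℝ)⁻¹ • ∑ i ∈ s, c i‖ ^ 2 =
      ((k : ℝ)⁻¹) ^ 2 * ((N1 - N2) * ∑ i, ‖c i‖ ^ 2) := by
    rw [← hsq, Finset.mul_sum]
    refine Finset.sum_congr rfl fun s hs ↦ ?_
    rw [Finset.mem_powersetCard_univ.1 hs, norm_smul, mul_pow]
    simp
  rw [h4]
  -- Dropping `N2` gives up the finite-population correction and leaves the bound for independent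
  -- draws.
  have h5 : (N1 - N2) * ∑ i, ‖c i‖ ^ 2 ≤ N1 * ∑ i, ‖c i‖ ^ 2 :=
    mul_le_mul_of_nonneg_right (by linarith) (Finset.sum_nonneg fun i _ ↦ by positivity)
  have h6 : N1 = k * Q.card / n := by field_simp; linarith
  calc _ ≤ (Q.card : ℝ)⁻¹ * (((k : ℝ)⁻¹) ^ 2 * (N1 * ∑ i, ‖c i‖ ^ 2)) := by gcongr
    _ = _ := by rw [h6]; field_simp

/-- Minkowski's inequality in quadratic mean, for a uniformly bounded second term. -/
lemma average_sq_le_of_le_add {ι : Type*} [Fintype ι] [Nonempty ι] (u w : ι → ℝ) {A B : ℝ}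
    (hA : 0 ≤ A) (hB : 0 ≤ B) (hw0 : ∀ i, 0 ≤ w i) (hw : ∀ i, w i ≤ u i + B)
    (hu : (Fintype.card ι : ℝ)⁻¹ * ∑ i, u i ^ 2 ≤ A ^ 2) :
    (Fintype.card ι : ℝ)⁻¹ * ∑ i, w i ^ 2 ≤ (A + B) ^ 2 := by
  have hN : (0 : ℝ) < Fintype.card ι := by exact_mod_cast Fintype.card_pos
  -- Cauchy–Schwarz: the mean is at most the quadratic mean.
  have h1 : (Fintype.card ι : ℝ)⁻¹ * ∑ i, u i ≤ A := by
    refine le_trans (le_abs_self _) (abs_le_of_sq_le_sq ?_ hA)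
    have h := sq_sum_le_card_mul_sum_sq (s := Finset.univ) (f := u)
    rw [Finset.card_univ] at h
    calc _ = ((Fintype.card ι : ℝ)⁻¹) ^ 2 * (∑ i, u i) ^ 2 := by ring
      _ ≤ ((Fintype.card ι : ℝ)⁻¹) ^ 2 * (Fintype.card ι * ∑ i, u i ^ 2) := by gcongr
      _ = (Fintype.card ι : ℝ)⁻¹ * ∑ i, u i ^ 2 := by field_simp
      _ ≤ A ^ 2 := hu
  have h2 : ∑ i, w i ^ 2 ≤ ∑ i, (u i ^ 2 + 2 * B * u i + B ^ 2) :=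
    Finset.sum_le_sum fun i _ ↦ by nlinarith [hw i, hw0 i]
  rw [Finset.sum_add_distrib, Finset.sum_add_distrib, ← Finset.mul_sum] at h2
  simp only [Finset.sum_const, Finset.card_univ, nsmul_eq_mul] at h2
  calc _ ≤ (Fintype.card ι : ℝ)⁻¹ * _ := mul_le_mul_of_nonneg_left h2 (by positivity)
    _ = (Fintype.card ι : ℝ)⁻¹ * ∑ i, u i ^ 2 + 2 * B * ((Fintype.card ι : ℝ)⁻¹ * ∑ i, u i)
        + B ^ 2 := by field_simp
    _ ≤ A ^ 2 + 2 * B * A + B ^ 2 := by gcongr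
    _ = _ := by ring

end Sampling

/-! ### Domains of the inverse retraction, and gradients of averages. -/

section Geometry

variable {E : Type*} [NormedAddCommGroup E] [NormedSpace ℝ E] [FiniteDimensional ℝ E]
  {M : Type*} [TopologicalSpace M] [ChartedSpace E M] [IsManifold 𝓘(ℝ, E) ∞ M]

omit [FiniteDimensional ℝ E] in
lemma Retraction.continuous_fiber (R : Retraction E M) (x : M) :
    Continuous fun ξ : E ↦ R x ξ :=
  R.contMDiff.continuous.comp
    (FiberBundle.continuous_totalSpaceMk E (fun x : M ↦ TangentSpace 𝓘(ℝ, E) x) x)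

omit [FiniteDimensional ℝ E] in
/-- A segment from the origin whose image under `R x` stays in the totally retractive set stays
in the domain on which `R x` is a diffeomorphism. -/
lemma IsTotallyRetractive.mem_source {R : Retraction E M} {X : Set M} {xs : M}
    {Φ : ∀ _ : M, PartialDiffeomorph 𝓘(ℝ, E) 𝓘(ℝ, E) E M ∞}
    (h : IsTotallyRetractive R X xs Φ) {x : M} (hx : x ∈ X) (ξ : E)
    (hξ : ∀ τ ∈ Icc (0 : ℝ) 1, R x (τ • ξ) ∈ X) : ξ ∈ (Φ x).source := by
  have hcont : Continuous fun τ : Icc (0 : ℝ) 1 ↦ (τ : ℝ) • ξ := by fun_prop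
  have hlift : Continuous fun τ : Icc (0 : ℝ) 1 ↦
      (Φ x).toOpenPartialHomeomorph.symm (R x ((τ : ℝ) • ξ)) :=
    (Φ x).toOpenPartialHomeomorph.continuousOn_symm.comp_continuous
      ((R.continuous_fiber x).comp hcont) fun τ ↦ h.subset_target x hx (hξ τ τ.2)
  -- The source need not be star-shaped, so a connectedness argument is used. `A` is open as a
  -- preimage of the source, closed as the set where the segment agrees with the lift of its image
  -- by the inverse chart, and contains `0`; hence it is all of `[0, 1]`.
  set A : Set (Icc (0 : ℝ) 1) := (fun τ : Icc (0 : ℝ) 1 ↦ (τ : ℝ) • ξ) ⁻¹' (Φ x).source with hA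
  have heq : A = {τ : Icc (0 : ℝ) 1 |
      (Φ x).toOpenPartialHomeomorph.symm (R x ((τ : ℝ) • ξ)) = (τ : ℝ) • ξ} := by
    ext τ
    constructor
    · intro hτ
      have := (Φ x).toOpenPartialHomeomorph.left_inv hτ
      rw [mem_ofPred_eq, ← h.eqOn x hx _ hτ]
      exact this
    · intro hτ
      have := (Φ x).toOpenPartialHomeomorph.map_target (h.subset_target x hx (hξ τ τ.2))
      rw [mem_ofPred_eq] at hτ
      rw [hτ] at this
      exact this
  have hclopen : IsClopen A := by
    refine ⟨?_, (Φ x).open_source.preimage hcont⟩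
    rw [heq]
    exact isClosed_eq hlift hcont
  have huniv := hclopen.eq_univ ⟨⟨0, by simp⟩, by simpa [hA] using h.zero_mem x hx⟩
  have h1 : (⟨1, by simp⟩ : Icc (0 : ℝ) 1) ∈ A := huniv ▸ mem_univ _
  simpa [hA] using h1

variable [RiemannianBundle (fun x : M ↦ TangentSpace 𝓘(ℝ, E) x)]

lemma inner_rgrad (h : M → ℝ) (x : M) (v : TangentSpace 𝓘(ℝ, E) x) :
    inner ℝ (rgrad E h x) v = mfderiv 𝓘(ℝ, E) 𝓘(ℝ, ℝ) h x v := by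
  have : CompleteSpace (TangentSpace 𝓘(ℝ, E) x) :=
    FiniteDimensional.complete ℝ (TangentSpace 𝓘(ℝ, E) x)
  exact InnerProductSpace.toDual_symm_apply

lemma rgrad_objective {n : ℕ} {f : Fin n → M → ℝ} {x : M}
    (hf : ∀ i, MDifferentiableAt 𝓘(ℝ, E) 𝓘(ℝ, ℝ) (f i) x) :
    rgrad E (objective f) x = (n : ℝ)⁻¹ • ∑ i, rgrad E (f i) x := by
  have h := (HasMFDerivAt.sum (t := Finset.univ)
    fun i _ ↦ (hf i).hasMFDerivAt).const_smul (n : ℝ)⁻¹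
  have hobj : ((n : ℝ)⁻¹ • ∑ i, f i) = objective f := by
    ext y
    simp [objective]
  rw [hobj] at h
  refine ext_inner_right ℝ fun v ↦ ?_
  rw [inner_rgrad, h.mfderiv, real_inner_smul_left, sum_inner]
  simp_rw [inner_rgrad]
  -- Retyped as functionals on the model space, the derivatives can be summed and evaluated
  -- termwise.
  let D : Fin n → E →L[ℝ] ℝ := fun i ↦ mfderiv 𝓘(ℝ, E) 𝓘(ℝ, ℝ) (f i) x
  have hD : ∀ w : E, (∑ i, D i) w = ∑ i, D i w := fun w ↦ by simp
  exact congrArg ((n : ℝ)⁻¹ * ·) (hD v)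

end Geometry

/-! ### What the adaptive batch size guarantees. -/

section BatchSize

/-- Either the batch is the whole population, and its gradient is exact, or its size is a ceiling of
at least `ασ²/γ` with `γ = β` or `γ = ε²`, so that the variance is at most `γ/α`. The sum of the two
bounds covers whichever term attains the minimum. -/
lemma Params.batchSize_spec (p : Params) {n : ℕ} [NeZero n] {α β : ℝ} (hσ : 0 < p.σ)
    (hε : 0 < p.ε) (hα : 0 < α) (hα₁ : α ≤ p.α₁) (hα₂ : p.setting = Setting.online → α ≤ p.α₂)
    (hβ : 0 ≤ β) :
    0 < p.batchSize n β ∧ (p.batchSize n β = n ∨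
      (p.batchSize n β : ℝ)⁻¹ * p.σ ^ 2 ≤ β / α + p.ε ^ 2 / α) := by
  have hn : 0 < n := Nat.pos_of_ne_zero (NeZero.ne n)
  have key : ∀ a γ : ℝ, α ≤ a → 0 < γ → 0 < ⌈a * p.σ ^ 2 / γ⌉₊ ∧
      (⌈a * p.σ ^ 2 / γ⌉₊ : ℝ)⁻¹ * p.σ ^ 2 ≤ γ / α := by
    intro a γ ha hγ
    have ha0 : 0 < a := hα.trans_le ha
    have hpos : 0 < a * p.σ ^ 2 / γ := by positivity
    refine ⟨Nat.ceil_pos.2 hpos, ?_⟩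
    calc _ ≤ (a * p.σ ^ 2 / γ)⁻¹ * p.σ ^ 2 := by
          gcongr
          exact Nat.le_ceil _
      _ = γ / a := by field_simp
      _ ≤ γ / α := by gcongr
  have hε2 : 0 < p.ε ^ 2 := by positivity
  have hcap : 0 < p.batchCap n ∧ (p.batchCap n = n ∨
      (p.batchCap n : ℝ)⁻¹ * p.σ ^ 2 ≤ β / α + p.ε ^ 2 / α) := by
    unfold Params.batchCap
    split
    · exact ⟨hn, Or.inl rfl⟩
    · rename_i hs
      obtain ⟨h1, h2⟩ := key p.α₂ (p.ε ^ 2) (hα₂ hs) hε2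
      refine ⟨lt_min h1 hn, ?_⟩
      rcases min_choice ⌈p.α₂ * p.σ ^ 2 / p.ε ^ 2⌉₊ n with h | h <;> rw [h]
      · exact Or.inr (h2.trans (le_add_of_nonneg_left (by positivity)))
      · exact Or.inl rfl
  unfold Params.batchSize
  split_ifs with h0
  · exact hcap
  · have hβ0 : 0 < β := lt_of_le_of_ne hβ (Ne.symm h0)
    obtain ⟨h1, h2⟩ := key p.α₁ β hα₁ hβ0
    refine ⟨lt_min h1 hcap.1, ?_⟩
    rcases min_choice ⌈p.α₁ * p.σ ^ 2 / β⌉₊ (p.batchCap n) with h | h <;> rw [h]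
    · exact Or.inr (h2.trans (le_add_of_nonneg_right (by positivity)))
    · exact hcap.2

end BatchSize

/-! ### One-step descent and the error of the gradient estimator. -/

section Estimator

variable {E : Type*} [NormedAddCommGroup E] [NormedSpace ℝ E] [FiniteDimensional ℝ E]
  {M : Type*} [TopologicalSpace M] [ChartedSpace E M] [IsManifold 𝓘(ℝ, E) ∞ M]
  [RiemannianBundle (fun x : M ↦ TangentSpace 𝓘(ℝ, E) x)]

/-- From the state `z = (x, v)`, the update stays continuously in `X`. -/
def StaysIn (p : Params) (R : Retraction E M) (X : Set M) (z : TangentBundle 𝓘(ℝ, E) M) : Prop :=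
  ∀ τ ∈ Icc (0 : ℝ) 1, R z.proj (-((τ * p.η) • z.snd)) ∈ X

/-- The squared error of `v` as an estimator of the gradient, at the state `z = (x, v)`. -/
noncomputable def sqError {n : ℕ} (f : Fin n → M → ℝ) (z : TangentBundle 𝓘(ℝ, E) M) : ℝ :=
  ‖z.snd - rgrad E (objective f) z.proj‖ ^ 2

/-- The squared norm of the gradient at the base point of `z`. -/
noncomputable def sqGrad {n : ℕ} (f : Fin n → M → ℝ) (z : TangentBundle 𝓘(ℝ, E) M) : ℝ :=
  ‖rgrad E (objective f) z.proj‖ ^ 2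

variable {n : ℕ} {p : Params} {R : Retraction E M} {T : VectorTransport R}
  {f : Fin n → M → ℝ} {X : Set M} {xs : M}
  {nabla : CovariantDerivative 𝓘(ℝ, E) E (fun x : M ↦ TangentSpace 𝓘(ℝ, E) x)}
  {P : ∀ (x : M) (ξ : TangentSpace 𝓘(ℝ, E) x),
      TangentSpace 𝓘(ℝ, E) x ≃ₗᵢ[ℝ] TangentSpace 𝓘(ℝ, E) (R x ξ)}
  {Φ : ∀ _ : M, PartialDiffeomorph 𝓘(ℝ, E) 𝓘(ℝ, E) E M ∞}
  {G H σ L Ll θ : ℝ} {z : TangentBundle 𝓘(ℝ, E) M}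

omit [FiniteDimensional ℝ E] [RiemannianBundle (fun x : M ↦ TangentSpace 𝓘(ℝ, E) x)] in
lemma StaysIn.proj_mem (h : StaysIn p R X z) : z.proj ∈ X := by
  have := h 0 (by simp)
  rwa [zero_mul, zero_smul, neg_zero, R.map_zero] at this

omit [FiniteDimensional ℝ E] [RiemannianBundle (fun x : M ↦ TangentSpace 𝓘(ℝ, E) x)] in
lemma StaysIn.advance_mem (h : StaysIn p R X z) : advance p R z ∈ X := by
  have := h 1 (by simp)
  rwa [one_mul] at this

omit [FiniteDimensional ℝ E] [RiemannianBundle (fun x : M ↦ TangentSpace 𝓘(ℝ, E) x)] in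
lemma StaysIn.mem_source (h : StaysIn p R X z) (hR : IsTotallyRetractive R X xs Φ) :
    -(p.η • z.snd) ∈ (Φ z.proj).source := by
  refine hR.mem_source h.proj_mem _ fun τ hτ ↦ ?_
  have := h τ hτ
  rwa [mul_smul, ← smul_neg] at this

namespace CommonAssumption

variable (hA : CommonAssumption nabla R T P f X xs Φ G H σ L Ll θ)
include hA

lemma rgrad_objective (x : M) :
    rgrad E (objective f) x = (n : ℝ)⁻¹ • ∑ i, rgrad E (f i) x :=
  _root_.rgrad_objective fun i ↦ (hA.contMDiff i).mdifferentiableAt (by simp)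

/-- Smoothness along `ξ = -ηv`, with the inner product rewritten by `-η⟨g, v⟩ = η/2 (‖v - g‖² - ‖g‖²
- ‖v‖²)`. -/
lemma descent (hz : StaysIn p R X z) :
    objective f (advance p R z) ≤ objective f z.proj - p.η / 2 * sqGrad f z
      - p.η / 2 * (1 - L * p.η) * ‖z.snd‖ ^ 2 + p.η / 2 * sqError f z := by
  have h := hA.smooth _ hz.proj_mem _ (hz.mem_source hA.totallyRetractive) hz.advance_mem
  refine h.trans (le_of_eq ?_)
  unfold sqError sqGrad
  rw [norm_sub_sq_real, inner_neg_right, inner_smul_right, norm_neg, norm_smul, mul_pow,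
    real_inner_comm, Real.norm_eq_abs, sq_abs]
  ring

/-- Insert parallel transport between the two gradients. The Lipschitz assumption controls one part
in quadratic mean, the transport assumption and the gradient bound control the other uniformly by
`θ‖ξ‖G`; Minkowski adds the constants. -/
lemma average_sq_increment_le [NeZero n] (hη : 0 ≤ p.η) (hG : 0 ≤ G) (hLl : 0 ≤ Ll) (hθ : 0 ≤ θ)
    (hz : StaysIn p R X z) :
    (n : ℝ)⁻¹ * ∑ i, ‖rgrad E (f i) (advance p R z)
      - T z.proj (-(p.η • z.snd)) (rgrad E (f i) z.proj)‖ ^ 2 ≤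
      (Ll + θ * G) ^ 2 * (p.η ^ 2 * ‖z.snd‖ ^ 2) := by
  have hs := hz.mem_source hA.totallyRetractive
  have hlip := hA.lipschitz _ hz.proj_mem _ hs hz.advance_mem
  have htr := hA.transport _ hz.proj_mem _ hs hz.advance_mem
  set ξ : TangentSpace 𝓘(ℝ, E) z.proj := -(p.η • z.snd) with hξ
  have hnξ : ‖ξ‖ = p.η * ‖z.snd‖ := by
    rw [hξ, norm_neg, norm_smul, Real.norm_of_nonneg hη]
  have h := average_sq_le_of_le_add
    (fun i ↦ ‖rgrad E (f i) z.proj - (P z.proj ξ).symm (rgrad E (f i) (R z.proj ξ))‖)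
    (fun i ↦ ‖rgrad E (f i) (R z.proj ξ) - T z.proj ξ (rgrad E (f i) z.proj)‖)
    (A := Ll * ‖ξ‖) (B := θ * ‖ξ‖ * G) (by positivity) (by positivity) (fun i ↦ norm_nonneg _)
    (fun i ↦ ?_) (by rw [mul_pow]; simpa using hlip)
  · rw [Fintype.card_fin] at h
    refine h.trans (le_of_eq ?_)
    rw [hnξ]
    ring
  -- The isometry `P` moves the Lipschitz difference from the tangent space at the old point to that
  -- at the new one.
  · have h1 : ‖rgrad E (f i) z.proj - (P z.proj ξ).symm (rgrad E (f i) (R z.proj ξ))‖ =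
        ‖rgrad E (f i) (R z.proj ξ) - P z.proj ξ (rgrad E (f i) z.proj)‖ := by
      rw [← (P z.proj ξ).norm_map, map_sub, LinearIsometryEquiv.apply_symm_apply, norm_sub_rev]
    have h2 := htr (rgrad E (f i) z.proj)
    have h3 : θ * ‖ξ‖ * ‖rgrad E (f i) z.proj‖ ≤ θ * ‖ξ‖ * G := by
      gcongr
      exact hA.grad_bound i _ hz.proj_mem
    rw [norm_sub_rev] at h2
    change _ ≤ ‖rgrad E (f i) z.proj - (P z.proj ξ).symm (rgrad E (f i) (R z.proj ξ))‖ + _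
    rw [h1]
    exact (norm_sub_le_norm_sub_add_norm_sub _ _ _).trans (by gcongr; exact h2.trans h3)

/-- The error of the recursive gradient estimator grows in mean square by at most the (scaled)
squared length of the step. -/
lemma expect_innerStep_sqError_le [NeZero n] (hη : 0 ≤ p.η) (hG : 0 ≤ G) (hLl : 0 ≤ Ll)
    (hθ : 0 ≤ θ) (hz : StaysIn p R X z) :
    expect (innerStep p R T f z) (sqError f) ≤
      sqError f z + (Ll + θ * G) ^ 2 * p.η ^ 2 / p.b * ‖z.snd‖ ^ 2 := by
  have hb : (0 : ℝ) < (p.b : ℕ) := by exact_mod_cast p.b.pos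
  have hinc := hA.average_sq_increment_le hη hG hLl hθ hz
  unfold innerStep
  rw [expect_map _ _ (Set.toFinite _), expect_uniformOfFintype]
  set ξ : TangentSpace 𝓘(ℝ, E) z.proj := -(p.η • z.snd) with hξ
  set y := advance p R z with hy
  set a : Fin n → TangentSpace 𝓘(ℝ, E) y := fun i ↦
    rgrad E (f i) y - T z.proj ξ (rgrad E (f i) z.proj) with ha
  set μ : TangentSpace 𝓘(ℝ, E) y := (n : ℝ)⁻¹ • ∑ i, a i with hμ
  have hn : (n : ℝ) ≠ 0 := NeZero.ne _
  have hμ' : μ = rgrad E (objective f) y - T z.proj ξ (rgrad E (objective f) z.proj) := by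
    rw [hA.rgrad_objective, hA.rgrad_objective, map_smul, map_sum, hμ, ← smul_sub,
      ← Finset.sum_sub_distrib]
  -- `d i` is the centred contribution of one draw: the new error is the transported old error plus
  -- the sum of `d` over the mini-batch.
  set d : Fin n → TangentSpace 𝓘(ℝ, E) y := fun i ↦ ((p.b : ℕ) : ℝ)⁻¹ • (a i - μ) with hd
  have hd0 : ∑ i, d i = 0 := by
    rw [← Finset.smul_sum, Finset.sum_sub_distrib, Finset.sum_const, Finset.card_univ,
      ← Nat.cast_smul_eq_nsmul ℝ, hμ]
    simp [smul_smul, hn]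
  have hsq : ∀ I : Fin p.b → Fin n,
      sqError f (⟨y, miniGrad E f I y - T z.proj ξ (miniGrad E f I z.proj - z.snd)⟩ :
        TangentBundle 𝓘(ℝ, E) M) =
      ‖T z.proj ξ (z.snd - rgrad E (objective f) z.proj) + ∑ j, d (I j)‖ ^ 2 := by
    intro I
    have : miniGrad E f I y - T z.proj ξ (miniGrad E f I z.proj - z.snd)
        - rgrad E (objective f) y =
        T z.proj ξ (z.snd - rgrad E (objective f) z.proj) + ∑ j, d (I j) := by
      have h1 : ∑ j, d (I j) = miniGrad E f I y - T z.proj ξ (miniGrad E f I z.proj) - μ := by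
        rw [← Finset.smul_sum, Finset.sum_sub_distrib, Finset.sum_const, Finset.card_univ,
          ← Nat.cast_smul_eq_nsmul ℝ, smul_sub, smul_smul, Fintype.card_fin,
          inv_mul_cancel₀ hb.ne', one_smul, Finset.sum_sub_distrib, smul_sub]
        simp only [miniGrad, map_smul, map_sum]
      rw [h1, hμ', map_sub, map_sub]
      abel
    rw [← this]
    rfl
  have havg := average_norm_add_sum_sq d hd0 p.b (T z.proj ξ (z.snd - rgrad E (objective f) z.proj))
  have hvar : (n : ℝ)⁻¹ * ∑ i, ‖d i‖ ^ 2 ≤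
      (((p.b : ℕ) : ℝ)⁻¹) ^ 2 * ((Ll + θ * G) ^ 2 * (p.η ^ 2 * ‖z.snd‖ ^ 2)) := by
    have h1 : ∑ i, ‖d i‖ ^ 2 = (((p.b : ℕ) : ℝ)⁻¹) ^ 2 * ∑ i, ‖a i - μ‖ ^ 2 := by
      rw [Finset.mul_sum]
      refine Finset.sum_congr rfl fun i _ ↦ ?_
      rw [hd, norm_smul, mul_pow, Real.norm_eq_abs, sq_abs]
    -- Centring only decreases the second moment, which the increment bound controls.
    have h2 : ∑ i, ‖a i - μ‖ ^ 2 ≤ ∑ i, ‖a i‖ ^ 2 := by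
      have := sum_norm_sub_average_sq_le a 0
      simpa only [sub_zero, Fintype.card_fin] using this
    calc _ = (((p.b : ℕ) : ℝ)⁻¹) ^ 2 * ((n : ℝ)⁻¹ * ∑ i, ‖a i - μ‖ ^ 2) := by rw [h1]; ring
      _ ≤ (((p.b : ℕ) : ℝ)⁻¹) ^ 2 * ((n : ℝ)⁻¹ * ∑ i, ‖a i‖ ^ 2) := by gcongr
      _ ≤ _ := by gcongr
  simp_rw [hsq]
  rw [Fintype.card_fun, Fintype.card_fin, Fintype.card_fin, Nat.cast_pow, havg,
    LinearIsometry.norm_map]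
  unfold sqError
  refine add_le_add le_rfl ?_
  calc _ ≤ ((p.b : ℕ) : ℝ) * ((((p.b : ℕ) : ℝ)⁻¹) ^ 2 *
        ((Ll + θ * G) ^ 2 * (p.η ^ 2 * ‖z.snd‖ ^ 2))) := by gcongr
    _ = _ := by field_simp

omit hA in
/-- The batch gradient at the start of an epoch has mean square error at most
`β / α + ε ^ 2 / α`. -/
lemma expect_epochStart_sqError_le [NeZero n]
    (hA : CommonAssumption nabla R T P f X xs Φ G H p.σ L Ll θ) {α β : ℝ} (hσ : 0 < p.σ)
    (hε : 0 < p.ε) (hα : 0 < α) (hα₁ : α ≤ p.α₁) (hα₂ : p.setting = Setting.online → α ≤ p.α₂)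
    (hβ : 0 ≤ β) {x : M} (hx : x ∈ X) :
    expect (epochStart E p f β x) (sqError f) ≤ β / α + p.ε ^ 2 / α := by
  obtain ⟨hk0, hk⟩ := p.batchSize_spec (n := n) hσ hε hα hα₁ hα₂ hβ
  have hkn := p.batchSize_le n β
  have hn : (n : ℝ) ≠ 0 := NeZero.ne _
  unfold epochStart
  rw [expect_map _ _ (by simp [PMF.support_uniformOfFinset, Finset.finite_toSet]),
    expect_uniformOfFinset]
  set c : Fin n → TangentSpace 𝓘(ℝ, E) x := fun i ↦
    rgrad E (f i) x - rgrad E (objective f) x with hc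
  have hc0 : ∑ i, c i = 0 := by
    rw [hc, Finset.sum_sub_distrib, Finset.sum_const, Finset.card_univ,
      ← Nat.cast_smul_eq_nsmul ℝ, hA.rgrad_objective]
    simp [smul_smul, hn]
  have hsq : ∀ s ∈ Finset.powersetCard (p.batchSize n β) (Finset.univ : Finset (Fin n)),
      sqError f (⟨x, batchGrad E f s x⟩ : TangentBundle 𝓘(ℝ, E) M) =
        ‖(s.card : ℝ)⁻¹ • ∑ i ∈ s, c i‖ ^ 2 := by
    intro s hs
    have hs0 : (s.card : ℝ) ≠ 0 := by
      rw [Finset.mem_powersetCard_univ.1 hs]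
      exact_mod_cast hk0.ne'
    have : (s.card : ℝ)⁻¹ • ∑ i ∈ s, c i = batchGrad E f s x - rgrad E (objective f) x := by
      rw [hc, Finset.sum_sub_distrib, Finset.sum_const, ← Nat.cast_smul_eq_nsmul ℝ, smul_sub,
        smul_smul, inv_mul_cancel₀ hs0, one_smul]
      rfl
    rw [this]
    rfl
  rw [Finset.sum_congr rfl hsq]
  rcases hk with hk | hk
  · have h0 : ∀ s ∈ Finset.powersetCard (p.batchSize n β) (Finset.univ : Finset (Fin n)),
        ‖(s.card : ℝ)⁻¹ • ∑ i ∈ s, c i‖ ^ 2 = 0 := by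
      intro s hs
      have : s = Finset.univ := by
        rw [← Finset.card_eq_iff_eq_univ, Finset.mem_powersetCard_univ.1 hs, hk, Fintype.card_fin]
      rw [this, hc0]
      simp
    rw [Finset.sum_congr rfl h0]
    simp only [Finset.sum_const_zero, mul_zero]
    positivity
  · refine (average_norm_batch_sq_le c hc0 _ hkn hk0).trans (le_trans ?_ hk)
    gcongr
    exact hA.variance_bound x hx

end CommonAssumption

end Estimator

/-! ### Summation over an epoch, over all epochs, and over the output. -/

section Convergence

variable {E : Type*} [NormedAddCommGroup E] [NormedSpace ℝ E] [FiniteDimensional ℝ E]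
  {M : Type*} [TopologicalSpace M] [ChartedSpace E M] [IsManifold 𝓘(ℝ, E) ∞ M]
  [RiemannianBundle (fun x : M ↦ TangentSpace 𝓘(ℝ, E) x)]
  {n : ℕ} [NeZero n] {p : Params} {R : Retraction E M} {T : VectorTransport R}
  {f : Fin n → M → ℝ} {X : Set M} {xs : M}
  {nabla : CovariantDerivative 𝓘(ℝ, E) E (fun x : M ↦ TangentSpace 𝓘(ℝ, E) x)}
  {P : ∀ (x : M) (ξ : TangentSpace 𝓘(ℝ, E) x),
      TangentSpace 𝓘(ℝ, E) x ≃ₗᵢ[ℝ] TangentSpace 𝓘(ℝ, E) (R x ξ)}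
  {Φ : ∀ _ : M, PartialDiffeomorph 𝓘(ℝ, E) 𝓘(ℝ, E) E M ∞}
  {G H σ L Ll θ : ℝ}

lemma finite_support_innerStep (z : TangentBundle 𝓘(ℝ, E) M) :
    (innerStep p R T f z).support.Finite :=
  finite_support_map _ _ (Set.toFinite _)

omit [NeZero n] in
lemma finite_support_epochStart (β : ℝ) (x : M) : (epochStart E p f β x).support.Finite :=
  finite_support_map _ _ (by simp [PMF.support_uniformOfFinset, Finset.finite_toSet])

lemma proj_of_mem_support_innerStep {z z' : TangentBundle 𝓘(ℝ, E) M}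
    (h : z' ∈ (innerStep p R T f z).support) : z'.proj = advance p R z := by
  unfold innerStep at h
  rw [PMF.mem_support_map_iff] at h
  obtain ⟨I, -, rfl⟩ := h
  rfl

omit [NeZero n] in
lemma proj_of_mem_support_epochStart {β : ℝ} {x : M} {z : TangentBundle 𝓘(ℝ, E) M}
    (h : z ∈ (epochStart E p f β x).support) : z.proj = x := by
  unfold epochStart at h
  rw [PMF.mem_support_map_iff] at h
  obtain ⟨I, -, rfl⟩ := h
  rfl

/-- The staying hypothesis speaks only of listed states. This carries it to the first state of an
epoch and to the final iterate, from which the next epoch starts. -/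
lemma mem_of_mem_support_innerLoop (k : ℕ) (z : TangentBundle 𝓘(ℝ, E) M) :
    ∀ r ∈ (innerLoop p R T f k z).support, z ∈ r.1 ∧ ∃ z' ∈ r.1, r.2 = advance p R z' := by
  induction k generalizing z with
  | zero => intro r hr; simp [innerLoop] at hr; simp [hr]
  | succ k ih =>
    intro r hr
    simp only [innerLoop, PMF.mem_support_bind_iff, PMF.mem_support_map_iff] at hr
    obtain ⟨z', -, r', hr', rfl⟩ := hr
    obtain ⟨-, w, hw, h⟩ := ih z' r' hr'
    exact ⟨by simp, w, by simp [hw], h⟩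

/-- Decrease of the objective along the inner loop. -/
lemma CommonAssumption.expect_innerLoop_le
    (hA : CommonAssumption nabla R T P f X xs Φ G H σ L Ll θ)
    (hη : 0 ≤ p.η) (hG : 0 ≤ G) (hLl : 0 ≤ Ll) (hθ : 0 ≤ θ) {c : ℝ} (k : ℕ) :
    ∀ z : TangentBundle 𝓘(ℝ, E) M,
      (∀ r ∈ (innerLoop p R T f k z).support, ∀ z' ∈ r.1, StaysIn p R X z') →
      k * ((Ll + θ * G) ^ 2 * p.η ^ 2 / p.b) + L * p.η + c ≤ 1 →
      expect (innerLoop p R T f k z) (fun r ↦ objective f r.2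
          + p.η / 2 * (r.1.map (sqGrad f)).sum
          + p.η / 2 * c * (r.1.map fun w ↦ ‖w.snd‖ ^ 2).sum) ≤
        objective f z.proj + p.η / 2 * (k + 1) * sqError f z := by
  set κ : ℝ := (Ll + θ * G) ^ 2 * p.η ^ 2 / p.b with hκ
  have hκ0 : 0 ≤ κ := by positivity
  induction k with
  | zero =>
    intro z hz hc
    have hzX : StaysIn p R X z := hz ([z], advance p R z) (by simp [innerLoop]) z (by simp)
    have h := hA.descent hzX
    simp only [innerLoop, expect_pure, List.map_cons, List.map_nil, List.sum_cons, List.sum_nil,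
      add_zero, Nat.cast_zero, zero_mul, zero_add] at hc ⊢
    have h2 : p.η / 2 * c * ‖z.snd‖ ^ 2 ≤ p.η / 2 * (1 - L * p.η) * ‖z.snd‖ ^ 2 := by
      gcongr
      linarith
    linarith
  | succ k ih =>
    intro z hz hc
    have hsub : ∀ z' ∈ (innerStep p R T f z).support, ∀ r ∈ (innerLoop p R T f k z').support,
        ∀ w ∈ z :: r.1, StaysIn p R X w := by
      intro z' hz' r hr
      refine hz (z :: r.1, r.2) ?_
      simp only [innerLoop, PMF.mem_support_bind_iff, PMF.mem_support_map_iff]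
      exact ⟨z', hz', r, hr, rfl⟩
    -- Supports are nonempty, so the current state belongs to at least one possible continuation, to
    -- which the hypothesis applies.
    have hzX : StaysIn p R X z := by
      obtain ⟨z', hz'⟩ := (innerStep p R T f z).support_nonempty
      obtain ⟨r, hr⟩ := (innerLoop p R T f k z').support_nonempty
      exact hsub z' hz' r hr z (by simp)
    push_cast at hc ⊢
    have hfin := finite_support_innerStep (p := p) (R := R) (T := T) (f := f) z
    rw [innerLoop, expect_bind _ _ hfin
      (fun z' ↦ finite_support_map _ _ (finite_support_innerLoop p R T f k z'))]
    -- The share of the current state in the two sums, constant with respect to the later draws.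
    set C : ℝ := p.η / 2 * sqGrad f z + p.η / 2 * c * ‖z.snd‖ ^ 2 with hC
    have hstep : ∀ z' ∈ (innerStep p R T f z).support,
        expect ((innerLoop p R T f k z').map fun r ↦ (z :: r.1, r.2)) (fun r ↦ objective f r.2
          + p.η / 2 * (r.1.map (sqGrad f)).sum
          + p.η / 2 * c * (r.1.map fun w ↦ ‖w.snd‖ ^ 2).sum) ≤
        (C + objective f (advance p R z)) + p.η / 2 * (k + 1) * sqError f z' := by
      intro z' hz'
      have h := ih z' (fun r hr w hw ↦ hsub z' hz' r hr w (by simp [hw])) (by linarith)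
      rw [proj_of_mem_support_innerStep hz'] at h
      rw [expect_map _ _ (finite_support_innerLoop p R T f k z')]
      have h2 := expect_affine _ (finite_support_innerLoop p R T f k z') C 1
        (fun r ↦ objective f r.2 + p.η / 2 * (r.1.map (sqGrad f)).sum
          + p.η / 2 * c * (r.1.map fun w ↦ ‖w.snd‖ ^ 2).sum)
      calc _ = _ := by
            congr 1
            ext r
            simp only [List.map_cons, List.sum_cons]
            rw [hC]
            ring
        _ = _ := h2
        _ ≤ _ := by linarith
    refine (expect_mono _ hfin hstep).trans ?_
    rw [expect_affine _ hfin]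
    have h1 := hA.expect_innerStep_sqError_le (p := p) hη hG hLl hθ hzX
    have h2 := hA.descent hzX
    rw [← hκ] at h1
    have h3 : p.η / 2 * (k + 1) * expect (innerStep p R T f z) (sqError f) ≤
        p.η / 2 * (k + 1) * (sqError f z + κ * ‖z.snd‖ ^ 2) := by gcongr
    -- The `k + 1` remaining states each inherit the error growth `κ ‖v‖²`. The descent at `z` pays
    -- for all of them and for the slack `c`, and adds the last unit to the weight `k + 2` of the
    -- error at `z`.
    have h4 : p.η / 2 * (c + (k + 1) * κ) * ‖z.snd‖ ^ 2 ≤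
        p.η / 2 * (1 - L * p.η) * ‖z.snd‖ ^ 2 := by
      gcongr
      linarith
    have h5 : p.η / 2 * (c + (k + 1) * κ) * ‖z.snd‖ ^ 2 =
      p.η / 2 * c * ‖z.snd‖ ^ 2 + p.η / 2 * (k + 1) * (κ * ‖z.snd‖ ^ 2) := by ring
    rw [hC]
    linarith

omit [NeZero n] [FiniteDimensional ℝ E] [IsManifold 𝓘(ℝ, E) ∞ M] in
lemma nextBeta_eq (l : List (TangentBundle 𝓘(ℝ, E) M)) :
    nextBeta p l = (l.map fun w ↦ ‖w.snd‖ ^ 2).sum / p.m := by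
  simp only [nextBeta, div_eq_mul_inv, List.sum_map_mul_right]

omit [NeZero n] [FiniteDimensional ℝ E] [IsManifold 𝓘(ℝ, E) ∞ M] in
lemma nextBeta_nonneg (l : List (TangentBundle 𝓘(ℝ, E) M)) : 0 ≤ nextBeta p l := by
  refine List.sum_nonneg fun a ha ↦ ?_
  obtain ⟨w, -, rfl⟩ := List.mem_map.1 ha
  positivity

/-- Total squared gradient norm over `k` epochs. -/
lemma CommonAssumption.expect_epochs_le
    (hA : CommonAssumption nabla R T P f X xs Φ G H p.σ L Ll θ) (hxs : IsMinOn (objective f) X xs)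
    (hη : 0 ≤ p.η) (hG : 0 ≤ G) (hLl : 0 ≤ Ll) (hθ : 0 ≤ θ) {α : ℝ} (hσ : 0 < p.σ)
    (hε : 0 < p.ε) (hα : 0 < α) (hα₁ : α ≤ p.α₁) (hα₂ : p.setting = Setting.online → α ≤ p.α₂)
    (hstep : p.m * ((Ll + θ * G) ^ 2 * p.η ^ 2 / p.b) + L * p.η + 1 / α ≤ 1) (k : ℕ) :
    ∀ (β : ℝ) (x : M), 0 ≤ β → x ∈ X →
      (∀ l ∈ (epochs p R T f k β x).support, ∀ z ∈ l, StaysIn p R X z) →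
      expect (epochs p R T f k β x) (fun l ↦ p.η / 2 * (l.map (sqGrad f)).sum) ≤
        objective f x - objective f xs + p.η / 2 * p.m * (β / α + k * (p.ε ^ 2 / α)) := by
  have hm : (0 : ℝ) < (p.m : ℕ) := by exact_mod_cast p.m.pos
  -- An epoch makes `m - 1` inner steps but visits `m` states.
  have hm1 : (((p.m : ℕ) - 1 : ℕ) : ℝ) + 1 = (p.m : ℕ) := by
    exact_mod_cast Nat.sub_add_cancel p.m.pos
  induction k with
  | zero =>
    intro β x hβ hx _
    simp only [epochs, expect_pure, List.map_nil, List.sum_nil, mul_zero, Nat.cast_zero, zero_mul,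
      add_zero]
    -- With no epoch left, minimality of `xs` makes the objective gap nonnegative.
    have := hxs hx
    rw [mem_ofPred_eq] at this
    have h2 : 0 ≤ p.η / 2 * p.m * (β / α) := by positivity
    linarith
  | succ k ih =>
    intro β x hβ hx hstay
    have hsub : ∀ z ∈ (epochStart E p f β x).support,
        ∀ r ∈ (innerLoop p R T f ((p.m : ℕ) - 1) z).support,
        ∀ l ∈ (epochs p R T f k (nextBeta p r.1) r.2).support,
        ∀ w ∈ r.1 ++ l, StaysIn p R X w := by
      intro z hz r hr l hl
      refine hstay (r.1 ++ l) ?_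
      simp only [epochs, PMF.mem_support_bind_iff, PMF.mem_support_map_iff]
      exact ⟨z, hz, r, hr, l, hl, rfl⟩
    have hsub' : ∀ z ∈ (epochStart E p f β x).support,
        ∀ r ∈ (innerLoop p R T f ((p.m : ℕ) - 1) z).support,
        ∀ w ∈ r.1, StaysIn p R X w := by
      intro z hz r hr w hw
      obtain ⟨l, hl⟩ := (epochs p R T f k (nextBeta p r.1) r.2).support_nonempty
      exact hsub z hz r hr l hl w (by simp [hw])
    have hfinE := fun r : List (TangentBundle 𝓘(ℝ, E) M) × M ↦
      finite_support_epochs p R T f k (nextBeta p r.1) r.2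
    have hfinI := finite_support_innerLoop p R T f ((p.m : ℕ) - 1)
    have hfinS := finite_support_epochStart (E := E) (p := p) (f := f) β x
    set D : ℝ := p.η / 2 * p.m * (k * (p.ε ^ 2 / α)) - objective f xs with hD
    have hr : ∀ z ∈ (epochStart E p f β x).support,
        ∀ r ∈ (innerLoop p R T f ((p.m : ℕ) - 1) z).support,
        expect ((epochs p R T f k (nextBeta p r.1) r.2).map fun l ↦ r.1 ++ l)
          (fun l ↦ p.η / 2 * (l.map (sqGrad f)).sum) ≤
        D + 1 * (objective f r.2 + p.η / 2 * (r.1.map (sqGrad f)).sum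
          + p.η / 2 * (1 / α) * (r.1.map fun w ↦ ‖w.snd‖ ^ 2).sum) := by
      intro z hz r hr
      obtain ⟨-, w, hw, hwr⟩ := mem_of_mem_support_innerLoop _ z r hr
      have hrX : r.2 ∈ X := hwr ▸ (hsub' z hz r hr w hw).advance_mem
      have h := ih (nextBeta p r.1) r.2 (nextBeta_nonneg _) hrX
        fun l hl w hw ↦ hsub z hz r hr l hl w (by simp [hw])
      have haff := expect_affine _ (hfinE r) (p.η / 2 * (r.1.map (sqGrad f)).sum) 1
        (fun l ↦ p.η / 2 * (l.map (sqGrad f)).sum)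
      -- The `β` cost of the remaining epochs is exactly the slack left by the current inner loop
      -- when `c = 1 / α`.
      have hβ' : p.η / 2 * p.m * (nextBeta p r.1 / α) =
          p.η / 2 * (1 / α) * (r.1.map fun w ↦ ‖w.snd‖ ^ 2).sum := by
        rw [nextBeta_eq]
        field_simp
      have hfun : expect (epochs p R T f k (nextBeta p r.1) r.2)
          (fun l ↦ p.η / 2 * ((r.1 ++ l).map (sqGrad f)).sum) =
          p.η / 2 * (r.1.map (sqGrad f)).sum + 1 * expect (epochs p R T f k (nextBeta p r.1) r.2)
            (fun l ↦ p.η / 2 * (l.map (sqGrad f)).sum) := by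
        rw [← haff]
        congr 1
        ext l
        rw [List.map_append, List.sum_append]
        ring
      rw [expect_map _ _ (hfinE r), hfun, hD]
      rw [mul_add, hβ'] at h
      linarith
    have hz : ∀ z ∈ (epochStart E p f β x).support,
        expect ((innerLoop p R T f ((p.m : ℕ) - 1) z).bind fun r ↦
          (epochs p R T f k (nextBeta p r.1) r.2).map fun l ↦ r.1 ++ l)
          (fun l ↦ p.η / 2 * (l.map (sqGrad f)).sum) ≤
        (D + objective f x) + p.η / 2 * p.m * sqError f z := by
      intro z hz
      rw [expect_bind _ _ (hfinI z) fun r ↦ finite_support_map _ _ (hfinE r)]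
      refine (expect_mono _ (hfinI z) (hr z hz)).trans ?_
      rw [expect_affine _ (hfinI z)]
      have h := hA.expect_innerLoop_le hη hG hLl hθ (c := 1 / α) ((p.m : ℕ) - 1) z (hsub' z hz) (by
        refine le_trans ?_ hstep
        gcongr
        exact Nat.sub_le _ _)
      rw [hm1, proj_of_mem_support_epochStart hz] at h
      linarith
    rw [epochs, expect_bind _ _ hfinS fun z ↦ finite_support_bind _ _ (hfinI z) fun r ↦
      finite_support_map _ _ (hfinE r)]
    refine (expect_mono _ hfinS hz).trans ?_
    rw [expect_affine _ hfinS]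
    have h := hA.expect_epochStart_sqError_le hσ hε hα hα₁ hα₂ hβ hx
    have h2 : p.η / 2 * p.m * expect (epochStart E p f β x) (sqError f) ≤
      p.η / 2 * p.m * (β / α + p.ε ^ 2 / α) := by gcongr
    push_cast
    rw [hD]
    linarith

/-- The output averages over the iterates of a run. -/
lemma expect_output (x₀ : M) (g : M → ℝ) :
    expect (output p R T f x₀) g =
      ((p.S * p.m : ℝ))⁻¹ * expect (run p R T f x₀) fun l ↦ (l.map fun z ↦ g z.proj).sum := by
  have hfin : (run p R T f x₀).support.Finite := finite_support_epochs p R T f _ _ _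
  unfold output
  rw [expect_bind _ _ hfin fun l ↦ finite_support_map _ _ (Set.toFinite _), ← expect_const_mul]
  refine expect_congr _ hfin fun l hl ↦ ?_
  have hlen := length_of_mem_support_run p R T f x₀ l hl
  rw [expect_map _ _ (Set.toFinite _), expect_uniformOfFintype, Fintype.card_fin, Nat.cast_mul]
  congr 1
  rw [← hlen, ← Fin.sum_univ_fun_getElem]
  exact Finset.sum_congr rfl fun i _ ↦ by
    rw [List.getD_eq_getElem _ _ i.2]

/-- The step size bound makes the quadratic `κ η ^ 2 + L η` at most `a`. -/
lemma quadratic_le_of_le_div_sqrt {κ L a η : ℝ} (hL : 0 < L) (hκ : 0 ≤ κ) (ha : 0 ≤ a)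
    (hη : 0 ≤ η) (h : η ≤ 2 * a / (L + √(L ^ 2 + 4 * a * κ))) : κ * η ^ 2 + L * η ≤ a := by
  set s := √(L ^ 2 + 4 * a * κ) with hs
  have hs2 : s ^ 2 = L ^ 2 + 4 * a * κ := Real.sq_sqrt (by positivity)
  have hs0 : 0 ≤ s := Real.sqrt_nonneg _
  rw [le_div_iff₀ (by positivity)] at h
  -- The case `a = 0` forces `η = 0`; it is separated because the factor `2 * a` is cancelled below.
  rcases ha.eq_or_lt with rfl | ha
  · have : η = 0 := by nlinarith
    simp [this]
  have hsL : L ≤ s := Real.le_sqrt_of_sq_le (by nlinarith [mul_nonneg ha.le hκ])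
  -- The bound on `η` is the rationalized positive root of the quadratic, which also makes sense for
  -- `κ = 0`. Here `4aκ = (s - L)(s + L)` and `η (L + s) ≤ 2a` combine.
  have h1 : 2 * a * (2 * (κ * η ^ 2)) ≤ 2 * a * (η * (s - L)) := by
    calc 2 * a * (2 * (κ * η ^ 2)) = η * (s - L) * (η * (L + s)) := by linear_combination -η ^ 2 * hs2
      _ ≤ η * (s - L) * (2 * a) :=
        mul_le_mul_of_nonneg_left h (mul_nonneg hη (sub_nonneg.2 hsL))
      _ = _ := by ring
  have h2 := le_of_mul_le_mul_left h1 (by positivity)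
  linarith

end Convergence

/-! ### The convergence theorem. -/

theorem mainTheorem2
    {E : Type*} [NormedAddCommGroup E] [NormedSpace ℝ E] [FiniteDimensional ℝ E]
    {M : Type*} [TopologicalSpace M] [ChartedSpace E M] [IsManifold 𝓘(ℝ, E) ∞ M]
    [RiemannianBundle (fun x : M ↦ TangentSpace 𝓘(ℝ, E) x)]
    [IsContMDiffRiemannianBundle 𝓘(ℝ, E) ∞ E (fun x : M ↦ TangentSpace 𝓘(ℝ, E) x)]
    (nabla : CovariantDerivative 𝓘(ℝ, E) E (fun x : M ↦ TangentSpace 𝓘(ℝ, E) x))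
    (hnabla : IsLeviCivita nabla)
    (R : Retraction E M) (T : VectorTransport R)
    (P : ∀ (x : M) (ξ : TangentSpace 𝓘(ℝ, E) x),
      TangentSpace 𝓘(ℝ, E) x ≃ₗᵢ[ℝ] TangentSpace 𝓘(ℝ, E) (R x ξ))
    (hP : ∀ (x : M) (ξ : TangentSpace 𝓘(ℝ, E) x), IsParallelTransport nabla R x ξ (P x ξ))
    {n : ℕ} [NeZero n] (f : Fin n → M → ℝ)
    (X : Set M) (xs : M) (hxs : IsMinOn (objective f) X xs)
    (Φ : ∀ _ : M, PartialDiffeomorph 𝓘(ℝ, E) 𝓘(ℝ, E) E M ∞)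
    (p : Params) (x₀ : M) (G H L Ll θ α : ℝ)
    (hG : 0 < G) (hH : 0 < H) (hσ : 0 < p.σ) (hL : 0 < L) (hLl : 0 < Ll) (hθ : 0 < θ)
    (hA : CommonAssumption nabla R T P f X xs Φ G H p.σ L Ll θ)
    -- the iterates stay continuously in `X`
    (hX : ∀ l ∈ (run p R T f x₀).support, ∀ z ∈ l, ∀ τ ∈ Icc (0 : ℝ) 1,
      R z.proj (-((τ * p.η) • z.snd)) ∈ X)
    (hε : 0 < p.ε) (hα : 4 ≤ α) (hα₁ : α ≤ p.α₁) (hα₂ : p.setting = Setting.online → α ≤ p.α₂)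
    (hβ₁ : 0 ≤ p.β₁) (hβ₁' : p.β₁ ≤ p.ε ^ 2 * p.S)
    (hη : 0 < p.η)
    (hη' : p.η ≤ (2 - 2 / α) /
      (L + √(L ^ 2 + 4 * (1 - 1 / α) * ((Ll + θ * G) ^ 2 * p.m / p.b)))) :
    expect (output p R T f x₀) (fun x ↦ ‖rgrad E (objective f) x‖ ^ 2) ≤
      2 * (objective f x₀ - objective f xs) / ((p.S * p.m : ℝ) * p.η) + p.ε ^ 2 / 2 := by
  have hα0 : 0 < α := by linarith
  have hS : (0 : ℝ) < (p.S : ℕ) := by exact_mod_cast p.S.pos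
  have hm : (0 : ℝ) < (p.m : ℕ) := by exact_mod_cast p.m.pos
  have hb : (0 : ℝ) < (p.b : ℕ) := by exact_mod_cast p.b.pos
  have hαinv : 1 / α ≤ 1 / 4 := one_div_le_one_div_of_le (by norm_num) hα
  -- The starting point lies in `X` because `S ≥ 1`: it is the base point of the first state of some
  -- possible run.
  have hx₀ : x₀ ∈ X := by
    obtain ⟨S', hS'⟩ : ∃ S', (p.S : ℕ) = S' + 1 := ⟨_, (Nat.sub_add_cancel p.S.pos).symm⟩
    obtain ⟨z, hz⟩ := (epochStart E p f p.β₁ x₀).support_nonempty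
    obtain ⟨r, hr⟩ := (innerLoop p R T f ((p.m : ℕ) - 1) z).support_nonempty
    obtain ⟨l, hl⟩ := (epochs p R T f S' (nextBeta p r.1) r.2).support_nonempty
    have hmem : r.1 ++ l ∈ (run p R T f x₀).support := by
      rw [run, hS']
      simp only [epochs, PMF.mem_support_bind_iff, PMF.mem_support_map_iff]
      exact ⟨z, hz, r, hr, l, hl, rfl⟩
    have hzX : StaysIn p R X z :=
      hX _ hmem z (by simp [(mem_of_mem_support_innerLoop _ z r hr).1])
    exact proj_of_mem_support_epochStart hz ▸ hzX.proj_mem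
  have hquad := quadratic_le_of_le_div_sqrt (κ := (Ll + θ * G) ^ 2 * p.m / p.b) (a := 1 - 1 / α)
    hL (by positivity) (by linarith) hη.le (hη'.trans (le_of_eq (by ring)))
  have hstep : p.m * ((Ll + θ * G) ^ 2 * p.η ^ 2 / p.b) + L * p.η + 1 / α ≤ 1 := by
    have : p.m * ((Ll + θ * G) ^ 2 * p.η ^ 2 / p.b) =
        (Ll + θ * G) ^ 2 * p.m / p.b * p.η ^ 2 := by ring
    linarith
  have h := hA.expect_epochs_le hxs hη.le hG.le hLl.le hθ.le hσ hε hα0 hα₁ hα₂ hstep p.S p.β₁ x₀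
    hβ₁ hx₀ hX
  rw [expect_const_mul] at h
  rw [expect_output]
  change _ * expect (epochs p R T f p.S p.β₁ x₀) (fun l ↦ (l.map (sqGrad f)).sum) ≤ _
  set Q := expect (epochs p R T f p.S p.β₁ x₀) (fun l ↦ (l.map (sqGrad f)).sum)
  -- The bound on `β₁` makes its cost at most that of the `S` accuracy terms; together they are
  -- `2Sε²/α`, and `α ≥ 4` gives the factor `1/2`.
  have hβ : p.β₁ / α + p.S * (p.ε ^ 2 / α) ≤ p.S * (p.ε ^ 2 / 2) := by
    calc _ ≤ p.ε ^ 2 * p.S / α + p.S * (p.ε ^ 2 / α) := by gcongr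
      _ = p.S * p.ε ^ 2 * 2 * (1 / α) := by ring
      _ ≤ p.S * p.ε ^ 2 * 2 * (1 / 4) := by gcongr
      _ = _ := by ring
  have h2 : p.η / 2 * Q ≤ objective f x₀ - objective f xs
      + p.η / 2 * p.m * (p.S * (p.ε ^ 2 / 2)) := h.trans (by gcongr)
  calc _ = 2 / (p.S * p.m * p.η) * (p.η / 2 * Q) := by field_simp
    _ ≤ 2 / (p.S * p.m * p.η) * (objective f x₀ - objective f xs
      + p.η / 2 * p.m * (p.S * (p.ε ^ 2 / 2))) := by gcongr
    _ = _ := by field_simp
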